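/- A circuit is a finite directed acyclic multigraph whose vertices are inputs (with no incoming edges) and gates, and whose edges are called wires; every wire originates at a vertex and either enters a gate or is an output wire of the circuit. All inputs are constants in $\{0,1\}$, except for one, which is a binary random variable $X$ with arbitrary distribution. Each gate computes a fixed Boolean function of the values carried by its incoming wires, with result $Y$, and outputs a noisy version $Z$ of $Y$. Every wire carries the output of its originating vertex. Fix $a,b\in[0,1]$ and suppose that all gates are $(a,b)$-noisy: for each gate, conditionally on the outputs of all vertices that cannot be reached from that gate along wires (these include $X$ and the gate's inputs, and hence determine $Y$), the output $Z$ has the distribution given by $\mathbb P(Z=1\mid Y=0)=a$ and $\mathbb P(Z=0\mid Y=1)=b$. Put $$c=c_{a,b}=1-\left(\sqrt{b(1-a)}+\sqrt{a(1-b)}\right)^2 .$$ Let $\mathbf W$ be an arbitrary collection of wires of the circuit, identified with the random values they carry, and let $I$ denote mutual information measured in bits. Then $$I(X;\mathbf W)\le\sum_{X\xrightarrow{P}\mathbf W}c^{|P|},$$ where the sum is over all directed paths $P$ from $X$ to $\mathbf W$, and $|P|$ is the number of gates (excluding inputs) on $P$. Here a path to a wire is a path to the originating vertex of the wire, this vertex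 is included in the count $|P|$, and paths passing through the same vertices are considered identical. -/

import Mathlib

open MeasureTheory

/-- The vertices of a circuit with a single variable input: the variable input `var`, the constant
inputs (indexed by `κ`) and the gates (indexed by `γ`). -/
inductive Vertex (κ γ : Type*) where
  | var : Vertex κ γ
  | const (i : κ) : Vertex κ γ
  | gate (g : γ) : Vertex κ γ

instance {κ γ : Type*} [Finite κ] [Finite γ] : Finite (Vertex κ γ) :=
  Finite.of_injective
    (fun v : Vertex κ γ => match v with
      | .var => (none : Option (κ ⊕ γ))
      | .const i => some (Sum.inl i)
      | .gate g => some (Sum.inr g))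
    (by rintro (_ | _ | _) (_ | _ | _) h <;> simp_all)

/-- Whether a vertex is a gate (as opposed to an input). -/
def Vertex.isGate {κ γ : Type*} : Vertex κ γ → Bool
  | .gate _ => true
  | _ => false

/-- The underlying directed multigraph: every wire `e` leaves a vertex `src e` and either
enters a gate `g` (`tgt e = some g`) or is a dangling output wire of the circuit
(`tgt e = none`). Inputs accept no wires. Parallel wires are allowed. -/
structure Wiring (κ γ E : Type*) where
  src : E → Vertex κ γ
  tgt : E → Option γ

/-- Some wire leads from `u` into `v`. -/
def Wiring.Adj {κ γ E : Type*} (G : Wiring κ γ E) (u v : Vertex κ γ) : Prop :=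
  ∃ (e : E) (g : γ), G.src e = u ∧ G.tgt e = some g ∧ v = Vertex.gate g

/-- A circuit with one variable input and constant inputs: an acyclic wiring, the values of the
constants, and for each gate the Boolean function that it computes (before noise) from the values
carried by the wires entering it. -/
structure Circuit (κ γ E : Type*) extends Wiring κ γ E where
  acyclic : ∀ v, ¬ Relation.TransGen toWiring.Adj v v
  constVal : κ → Bool
  compute : (g : γ) → ({e : E // tgt e = some g} → Bool) → Bool

namespace Circuit

variable {κ γ E : Type*} (C : Circuit κ γ E)

/-- The noiseless result `Y` of gate `g` when the vertices output the values `s`. -/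
def preNoise (s : Vertex κ γ → Bool) (g : γ) : Bool :=
  C.compute g fun e => s (C.src e.1)

/-- `v` is `u` itself or is reachable from `u` along wires. -/
def Downstream (u v : Vertex κ γ) : Prop :=
  Relation.ReflTransGen C.Adj u v

/-- A directed path from the variable input to (the originating vertex of) a wire in `W`, given by
the list of the vertices on it, the originating vertex included. -/
def IsPathTo (W : Finset E) (P : List (Vertex κ γ)) : Prop :=
  P.IsChain C.Adj ∧ P.head? = some Vertex.var ∧ ∃ e ∈ W, P.getLast? = some (C.src e)

theorem IsPathTo.nodup {C : Circuit κ γ E} {W : Finset E} {P : List (Vertex κ γ)}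
    (h : C.IsPathTo W P) : P.Nodup := by
  have h1 : P.IsChain (Relation.TransGen C.Adj) :=
    h.1.imp fun _ _ hab => Relation.TransGen.single hab
  have h2 : P.Pairwise (Relation.TransGen C.Adj) := List.isChain_iff_pairwise.mp h1
  refine h2.imp ?_
  rintro u v huv rfl
  exact C.acyclic u huv

theorem finite_paths [Finite κ] [Finite γ] (W : Finset E) :
    {P : List (Vertex κ γ) | C.IsPathTo W P}.Finite := by
  refine (List.finite_length_le (Vertex κ γ) (Nat.card (Vertex κ γ))).subset fun P hP => ?_
  have := Fintype.ofFinite (Vertex κ γ)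
  change P.length ≤ _
  rw [Nat.card_eq_fintype_card]
  exact (IsPathTo.nodup hP).length_le_card

/-- The finite set of all paths from the variable input to `W`. Paths through the same vertices
are identified. -/
noncomputable def paths [Finite κ] [Finite γ] (W : Finset E) : Finset (List (Vertex κ γ)) :=
  (C.finite_paths W).toFinset

end Circuit

/-- The number of gates on a path. -/
def gateCount {κ γ : Type*} (P : List (Vertex κ γ)) : ℕ :=
  P.countP Vertex.isGate

/-- Transition probabilities of the binary channel with error probabilities `a` (a `0` becomes
a `1`) and `b` (a `1` becomes a `0`): the probability of output `z` given input `y`. -/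
def binaryChannel (a b : ℝ) : Bool → Bool → ℝ
  | false, true => a
  | false, false => 1 - a
  | true, false => b
  | true, true => 1 - b

/-- The information transmission bound `c_{a,b}`. -/
noncomputable def transmissionBound (a b : ℝ) : ℝ :=
  1 - (√(b * (1 - a)) + √(a * (1 - b))) ^ 2

/-- The random variables `Z v` (the output of vertex `v`) arise from running the circuit on the
random input bit `X` with `(a, b)`-noisy gates: the constant inputs and `X` are as prescribed, and
conditionally on the outputs of all the vertices that are not downstream of a gate `g` (these
include the inputs of `g`), the output of `g` is distributed as the noiseless result of `g` sent
through the binary channel with error probabilities `a` and `b`. -/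
structure Circuit.IsNoisyRun {κ γ E Ω : Type*} [MeasurableSpace Ω] (C : Circuit κ γ E) (a b : ℝ)
    (μ : Measure Ω) (X : Ω → Bool) (Z : Vertex κ γ → Ω → Bool) : Prop where
  measurable : ∀ v, Measurable (Z v)
  var_eq : Z Vertex.var = X
  const_eq : ∀ i ω, Z (Vertex.const i) ω = C.constVal i
  gate_noise : ∀ (g : γ) (s : Vertex κ γ → Bool) (z : Bool),
    μ.real {ω | (∀ v, ¬ C.Downstream (Vertex.gate g) v → Z v ω = s v) ∧ Z (Vertex.gate g) ω = z} =
      μ.real {ω | ∀ v, ¬ C.Downstream (Vertex.gate g) v → Z v ω = s v} *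
        binaryChannel a b (C.preNoise s g) z

/-- Mutual information in bits of two random variables with finitely many values:
`I(X;Y) = ∑ p(x,y) log₂ (p(x,y) / (p(x) p(y)))`. Terms with `p(x,y) = 0` vanish. -/
noncomputable def mutualInfo {Ω α β : Type*} [MeasurableSpace Ω] [Fintype α] [Fintype β]
    (μ : Measure Ω) (X : Ω → α) (Y : Ω → β) : ℝ :=
  ∑ x, ∑ y, μ.real {ω | X ω = x ∧ Y ω = y} *
    Real.logb 2 (μ.real {ω | X ω = x ∧ Y ω = y} / (μ.real {ω | X ω = x} * μ.real {ω | Y ω = y}))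

/-!
The proof combines a strong data processing inequality for the binary channel with an induction
that replaces gates by their incoming wires.

*Contraction.* Let `Z` be the output of the binary channel with input `Y`, and let `c` be
`transmissionBound a b`. With `p ↦ L p` the map from `P(Y = 1)` to `P(Z = 1)`, both `I(X; Y)` and
`I(X; Z)` are Jensen gaps, of the binary entropy `h` and of `h ∘ L` respectively. Hence
`I(X; Z) ≤ c * I(X; Y)` holds for all sources `X` as soon as `c * h - h ∘ L` is concave
(`concaveOn_binEntropy_sub_channelOut`). Comparing second derivatives, this amounts to
`(1 - a - b)² p (1 - p) ≤ c * L p * (1 - L p)`, which holds because the difference of the two sides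
is `c` times a perfect square. To condition on side information `T` without dividing by
probabilities, concavity is used in its homogeneous form: the perspective of a concave function is
superadditive. As `X` is a bit, everything can be expressed by one function of two masses,
`splitEntropy`. Summing over the values of `T` gives
`I(X; T, Z) ≤ (1 - c) * I(X; T) + c * I(X; T, Y)` (`mutualInfo_channel_le`).

*Induction.* Let `g` be a gate such that no other wire of `W` leaves a vertex downstream of `g`, let
`V` be the wires of `W` that do not leave `g`, and let `U` be the wires entering `g`. The noise of
`g` is independent of `X` and of the values on `V ∪ U`, and the noiseless result is a function of the
values on `U`, so that `I(X; W) ≤ (1 - c) * I(X; V) + c * I(X; V ∪ U)`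
(`Circuit.IsNoisyRun.mutualInfo_wires_le`). The path sums satisfy the matching inequality
`(1 - c) * S(V) + c * (S(V) + S(U)) ≤ S(W)`, since every path to `U` extends by `g` to a path to `W`.
Removing the vertices one by one, most downstream first, gives the bound; constants carry no
information, and as soon as a wire of `W` leaves the variable input, the one-vertex path contributes
`1`, which bounds the entropy of a bit.
-/

/-! ### Entropy of the binary channel -/

/-- The probability that the binary channel outputs `1` when its input is `1` with
probability `p`. -/
def channelOut (a b p : ℝ) : ℝ :=
  a * (1 - p) + (1 - b) * p

theorem transmissionBound_nonneg {a b : ℝ} (ha : a ∈ Set.Icc (0 : ℝ) 1)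
    (hb : b ∈ Set.Icc (0 : ℝ) 1) : 0 ≤ transmissionBound a b := by
  obtain ⟨ha0, ha1⟩ := ha
  obtain ⟨hb0, hb1⟩ := hb
  have h1 := Real.sq_sqrt (mul_nonneg hb0 (sub_nonneg.2 ha1))
  have h2 := Real.sq_sqrt (mul_nonneg ha0 (sub_nonneg.2 hb1))
  have h3 : √(b * (1 - a)) * √(a * (1 - b)) = √(a * (1 - a)) * √(b * (1 - b)) := by
    rw [← Real.sqrt_mul (mul_nonneg hb0 (sub_nonneg.2 ha1)),
      ← Real.sqrt_mul (mul_nonneg ha0 (sub_nonneg.2 ha1))]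
    congr 1; ring
  have h4 := Real.sq_sqrt (mul_nonneg ha0 (sub_nonneg.2 ha1))
  have h5 := Real.sq_sqrt (mul_nonneg hb0 (sub_nonneg.2 hb1))
  unfold transmissionBound
  nlinarith [sq_nonneg (√(a * (1 - a)) - √(b * (1 - b))), sq_nonneg (a + b - 1)]

theorem transmissionBound_le_one (a b : ℝ) : transmissionBound a b ≤ 1 := by
  unfold transmissionBound
  linarith [sq_nonneg (√(b * (1 - a)) + √(a * (1 - b)))]

/-- Writing `a = sin² α` and `b = sin² β`, the bound is `cos² (α + β)`, and this is the identity
`cos (α + β) * cos (α - β) = 1 - sin² α - sin² β`, squared. -/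
theorem sq_one_sub_sub_eq_transmissionBound_mul {a b : ℝ} (ha : a ∈ Set.Icc (0 : ℝ) 1)
    (hb : b ∈ Set.Icc (0 : ℝ) 1) :
    (1 - a - b) ^ 2 =
      transmissionBound a b * (√a * √b + √(1 - a) * √(1 - b)) ^ 2 := by
  obtain ⟨ha0, ha1⟩ := ha
  obtain ⟨hb0, hb1⟩ := hb
  have h1 := Real.sq_sqrt ha0
  have h2 := Real.sq_sqrt hb0
  have h3 := Real.sq_sqrt (sub_nonneg.2 ha1)
  have h4 := Real.sq_sqrt (sub_nonneg.2 hb1)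
  unfold transmissionBound
  rw [Real.sqrt_mul hb0, Real.sqrt_mul ha0]
  set p := √a
  set q := √b
  set r := √(1 - a)
  set s := √(1 - b)
  have e1 : r ^ 2 = 1 - p ^ 2 := by rw [h1, h3]
  have e2 : s ^ 2 = 1 - q ^ 2 := by rw [h2, h4]
  have e3 : 1 - (q * r + p * s) ^ 2 = (r * s - p * q) ^ 2 := by
    linear_combination (-q ^ 2 - s ^ 2) * e1 + (-p ^ 2 - (1 - p ^ 2)) * e2
  rw [e3, ← mul_pow]
  congr 1
  rw [← h1, ← h2]
  linear_combination (-s ^ 2) * e1 - (1 - p ^ 2) * e2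

/-- The inequality between second derivatives that makes
`c * binEntropy p - binEntropy (channelOut a b p)` concave in `p`. -/
theorem sq_mul_le_transmissionBound_mul {a b p : ℝ} (ha : a ∈ Set.Icc (0 : ℝ) 1)
    (hb : b ∈ Set.Icc (0 : ℝ) 1) :
    (1 - a - b) ^ 2 * (p * (1 - p)) ≤
      transmissionBound a b * (channelOut a b p * (1 - channelOut a b p)) := by
  rw [sq_one_sub_sub_eq_transmissionBound_mul ha hb, mul_assoc]
  refine mul_le_mul_of_nonneg_left ?_ (transmissionBound_nonneg ha hb)
  have h1 := Real.sq_sqrt ha.1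
  have h2 := Real.sq_sqrt hb.1
  have h3 := Real.sq_sqrt (sub_nonneg.2 ha.2)
  have h4 := Real.sq_sqrt (sub_nonneg.2 hb.2)
  unfold channelOut
  set x := √a
  set y := √b
  set r := √(1 - a)
  set s := √(1 - b)
  -- the difference of the two sides is a perfect square
  have : (a * (1 - p) + (1 - b) * p) * (1 - (a * (1 - p) + (1 - b) * p)) -
      (x * y + r * s) ^ 2 * (p * (1 - p)) = (x * r * (1 - p) - y * s * p) ^ 2 := by
    have e : 1 - (a * (1 - p) + (1 - b) * p) = (1 - a) * (1 - p) + b * p := by ring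
    rw [e, ← h3, ← h4]
    linear_combination (-(1 - p) * (r ^ 2 * (1 - p) + b * p)) * h1 -
      (x ^ 2 * (1 - p) + s ^ 2 * p) * p * h2
  nlinarith [sq_nonneg (x * r * (1 - p) - y * s * p)]

theorem channelOut_mem_Icc {a b p : ℝ} (ha : a ∈ Set.Icc (0 : ℝ) 1)
    (hb : b ∈ Set.Icc (0 : ℝ) 1) (hp : p ∈ Set.Icc (0 : ℝ) 1) :
    channelOut a b p ∈ Set.Icc (0 : ℝ) 1 := by
  obtain ⟨ha0, ha1⟩ := ha
  obtain ⟨hb0, hb1⟩ := hb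
  obtain ⟨hp0, hp1⟩ := hp
  unfold channelOut
  constructor <;> nlinarith [mul_nonneg ha0 (sub_nonneg.2 hp1), mul_nonneg (sub_nonneg.2 hb1) hp0,
    mul_nonneg (sub_nonneg.2 ha1) (sub_nonneg.2 hp1), mul_nonneg hb0 hp0]

/-- The analytic core of the strong data processing inequality: for every information source, the
Jensen gap of the output entropy is at most `transmissionBound a b` times that of the input
entropy. -/
theorem concaveOn_binEntropy_sub_channelOut {a b : ℝ} (ha : a ∈ Set.Icc (0 : ℝ) 1)
    (hb : b ∈ Set.Icc (0 : ℝ) 1) :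
    ConcaveOn ℝ (Set.Icc 0 1) fun p =>
      transmissionBound a b * Real.binEntropy p - Real.binEntropy (channelOut a b p) := by
  have hc := transmissionBound_nonneg ha hb
  by_cases hθ : 1 - a - b = 0
  · have h : ∀ p, channelOut a b p = a := fun p => by
      unfold channelOut; linear_combination p * hθ
    simp only [h]
    exact (Real.strictConcave_binEntropy.concaveOn.smul hc).sub
      (convexOn_const _ (convex_Icc 0 1))
  -- with `a + b ≠ 1`, the output is deterministic at most for deterministic input
  have hL : ∀ p ∈ Set.Ioo (0 : ℝ) 1, 0 < channelOut a b p * (1 - channelOut a b p) := by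
    intro p hp
    have h1 := sq_mul_le_transmissionBound_mul (p := p) ha hb
    have h2 : 0 < (1 - a - b) ^ 2 * (p * (1 - p)) :=
      mul_pos (by positivity) (mul_pos hp.1 (sub_pos.2 hp.2))
    exact (pos_iff_pos_of_mul_pos (h2.trans_le h1)).1
      (pos_of_mul_pos_left (h2.trans_le h1) (mul_nonneg
        (channelOut_mem_Icc ha hb (Set.Ioo_subset_Icc_self hp)).1
        (sub_nonneg.2 (channelOut_mem_Icc ha hb (Set.Ioo_subset_Icc_self hp)).2)))
  have hlog : ∀ x : ℝ, x ≠ 0 → 1 - x ≠ 0 →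
      HasDerivAt (fun y => Real.log (1 - y) - Real.log y) (-1 / (1 - x) - 1 / x) x := by
    intro x h0 h1
    exact (((hasDerivAt_id x).const_sub 1).log h1).sub ((hasDerivAt_id x).log h0)
  have hlin : ∀ p, HasDerivAt (channelOut a b) (1 - a - b) p := by
    intro p
    have := (((hasDerivAt_id p).const_sub 1).const_mul a).add
      ((hasDerivAt_id p).const_mul (1 - b))
    refine this.congr_deriv ?_
    ring
  refine concaveOn_of_hasDerivWithinAt2_nonpos (convex_Icc 0 1)
    (f' := fun p => transmissionBound a b * (Real.log (1 - p) - Real.log p) -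
      (Real.log (1 - channelOut a b p) - Real.log (channelOut a b p)) * (1 - a - b))
    (f'' := fun p => transmissionBound a b * (-1 / (1 - p) - 1 / p) -
      (-1 / (1 - channelOut a b p) - 1 / channelOut a b p) * (1 - a - b) * (1 - a - b))
    ?_ ?_ ?_ ?_
  · have : Continuous (channelOut a b) := by unfold channelOut; fun_prop
    exact Continuous.continuousOn (by fun_prop)
  all_goals
    rw [interior_Icc]
    intro p hp
    have hp0 : p ≠ 0 := hp.1.ne'
    have hp1 : 1 - p ≠ 0 := (sub_pos.2 hp.2).ne'
    have h0 : channelOut a b p ≠ 0 := left_ne_zero_of_mul (hL p hp).ne'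
    have h1 : 1 - channelOut a b p ≠ 0 := right_ne_zero_of_mul (hL p hp).ne'
  · exact (((Real.hasDerivAt_binEntropy hp0 hp.2.ne).const_mul _).sub
      ((Real.hasDerivAt_binEntropy h0 fun h => h1 (by rw [h, sub_self])).comp p
        (hlin p))).hasDerivWithinAt
  · exact (((hlog p hp0 hp1).const_mul _).sub
      (((hlog _ h0 h1).comp p (hlin p)).mul_const _)).hasDerivWithinAt
  · have e : transmissionBound a b * (-1 / (1 - p) - 1 / p) -
        (-1 / (1 - channelOut a b p) - 1 / channelOut a b p) * (1 - a - b) * (1 - a - b) =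
        ((1 - a - b) ^ 2 * (p * (1 - p)) -
          transmissionBound a b * (channelOut a b p * (1 - channelOut a b p))) /
        (p * (1 - p) * (channelOut a b p * (1 - channelOut a b p))) := by
      field_simp
      ring
    refine e.trans_le ?_
    exact div_nonpos_of_nonpos_of_nonneg
      (sub_nonpos.2 (sq_mul_le_transmissionBound_mul (p := p) ha hb))
      (mul_pos (mul_pos hp.1 (sub_pos.2 hp.2)) (hL p hp)).le

/-- The perspective of a concave function on the unit interval is superadditive. -/
theorem ConcaveOn.perspective_superadditive {f : ℝ → ℝ} (hf : ConcaveOn ℝ (Set.Icc 0 1) f)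
    {u₀ u₁ v₀ v₁ : ℝ} (hu₀ : 0 ≤ u₀) (hu₁ : 0 ≤ u₁) (hv₀ : 0 ≤ v₀) (hv₁ : 0 ≤ v₁) :
    (u₀ + u₁) * f (u₁ / (u₀ + u₁)) + (v₀ + v₁) * f (v₁ / (v₀ + v₁)) ≤
      (u₀ + v₀ + (u₁ + v₁)) * f ((u₁ + v₁) / (u₀ + v₀ + (u₁ + v₁))) := by
  have hu := add_nonneg hu₀ hu₁
  have hv := add_nonneg hv₀ hv₁
  obtain hu' | hu' := hu.eq_or_lt
  · obtain rfl : u₀ = 0 := by linarith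
    obtain rfl : u₁ = 0 := by linarith
    simp
  have hs : 0 < u₀ + v₀ + (u₁ + v₁) := by linarith
  have mem : ∀ {x y : ℝ}, 0 ≤ x → 0 ≤ y → y / (x + y) ∈ Set.Icc (0 : ℝ) 1 := fun hx hy =>
    ⟨div_nonneg hy (add_nonneg hx hy), div_le_one_of_le₀ (by linarith) (add_nonneg hx hy)⟩
  have h := hf.2 (mem hu₀ hu₁) (mem hv₀ hv₁) (div_nonneg hu hs.le) (div_nonneg hv hs.le)
    (by field_simp; ring)
  have hv1 : (v₀ + v₁) * (v₁ / (v₀ + v₁)) = v₁ := by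
    obtain hv' | hv' := hv.eq_or_lt
    · obtain rfl : v₁ = 0 := by linarith
      simp
    · field_simp
  have hu1 : (u₀ + u₁) * (u₁ / (u₀ + u₁)) = u₁ := by field_simp
  have e : (u₀ + u₁) / (u₀ + v₀ + (u₁ + v₁)) * (u₁ / (u₀ + u₁)) +
      (v₀ + v₁) / (u₀ + v₀ + (u₁ + v₁)) * (v₁ / (v₀ + v₁)) =
      (u₁ + v₁) / (u₀ + v₀ + (u₁ + v₁)) := by
    rw [div_mul_eq_mul_div, hu1, div_mul_eq_mul_div, hv1, ← add_div]
  simp only [smul_eq_mul] at h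
  rw [e, div_mul_eq_mul_div, div_mul_eq_mul_div, ← add_div, div_le_iff₀ hs] at h
  linarith

/-- The entropy, in nats, of a binary variable that takes its two values with the (not necessarily
normalized) masses `u₀` and `u₁`, times the total mass. -/
noncomputable def splitEntropy (u₀ u₁ : ℝ) : ℝ :=
  Real.negMulLog u₀ + Real.negMulLog u₁ - Real.negMulLog (u₀ + u₁)

theorem splitEntropy_eq_mul_binEntropy {u₀ u₁ : ℝ} (h₀ : 0 ≤ u₀) (h₁ : 0 ≤ u₁) :
    splitEntropy u₀ u₁ = (u₀ + u₁) * Real.binEntropy (u₁ / (u₀ + u₁)) := by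
  obtain h | h := (add_nonneg h₀ h₁).eq_or_lt
  · obtain rfl : u₀ = 0 := by linarith
    obtain rfl : u₁ = 0 := by linarith
    simp [splitEntropy]
  have e₁ : (u₀ + u₁) * (u₁ / (u₀ + u₁)) = u₁ := by field_simp
  have e₀ : (u₀ + u₁) * (1 - u₁ / (u₀ + u₁)) = u₀ := by field_simp; ring
  have n₁ := Real.negMulLog_mul (u₀ + u₁) (u₁ / (u₀ + u₁))
  have n₀ := Real.negMulLog_mul (u₀ + u₁) (1 - u₁ / (u₀ + u₁))
  rw [e₁] at n₁
  rw [e₀] at n₀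
  rw [splitEntropy, Real.binEntropy_eq_negMulLog_add_negMulLog_one_sub]
  linear_combination n₁ + n₀

theorem splitEntropy_superadditive {u₀ u₁ v₀ v₁ : ℝ} (hu₀ : 0 ≤ u₀) (hu₁ : 0 ≤ u₁)
    (hv₀ : 0 ≤ v₀) (hv₁ : 0 ≤ v₁) :
    splitEntropy u₀ u₁ + splitEntropy v₀ v₁ ≤ splitEntropy (u₀ + v₀) (u₁ + v₁) := by
  rw [splitEntropy_eq_mul_binEntropy hu₀ hu₁, splitEntropy_eq_mul_binEntropy hv₀ hv₁,
    splitEntropy_eq_mul_binEntropy (add_nonneg hu₀ hv₀) (add_nonneg hu₁ hv₁)]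
  exact Real.strictConcave_binEntropy.concaveOn.perspective_superadditive hu₀ hu₁ hv₀ hv₁

theorem sum_splitEntropy_le {ι : Type*} (s : Finset ι) {f g : ι → ℝ} (hf : ∀ i, 0 ≤ f i)
    (hg : ∀ i, 0 ≤ g i) :
    ∑ i ∈ s, splitEntropy (f i) (g i) ≤ splitEntropy (∑ i ∈ s, f i) (∑ i ∈ s, g i) := by
  classical
  induction s using Finset.induction_on with
  | empty => simp [splitEntropy]
  | insert i s hi ih =>
    rw [Finset.sum_insert hi, Finset.sum_insert hi, Finset.sum_insert hi]
    have := splitEntropy_superadditive (hf i) (hg i) (Finset.sum_nonneg (s := s) fun j _ => hf j)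
      (Finset.sum_nonneg (s := s) fun j _ => hg j)
    linarith

/-- The mass of the output `z` of the binary channel when the inputs `0` and `1` have masses `u₀`
and `u₁`. -/
def channelMass (a b u₀ u₁ : ℝ) (z : Bool) : ℝ :=
  u₀ * binaryChannel a b false z + u₁ * binaryChannel a b true z

theorem channelMass_nonneg {a b u₀ u₁ : ℝ} (ha : a ∈ Set.Icc (0 : ℝ) 1)
    (hb : b ∈ Set.Icc (0 : ℝ) 1) (h₀ : 0 ≤ u₀) (h₁ : 0 ≤ u₁) (z : Bool) :
    0 ≤ channelMass a b u₀ u₁ z := by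
  have := sub_nonneg.2 ha.2
  have := sub_nonneg.2 hb.2
  have := ha.1
  have := hb.1
  cases z <;> simp only [channelMass, binaryChannel] <;> positivity

theorem channelMass_false_add_true (a b u₀ u₁ : ℝ) :
    channelMass a b u₀ u₁ false + channelMass a b u₀ u₁ true = u₀ + u₁ := by
  simp only [channelMass, binaryChannel]
  ring

theorem splitEntropy_channelMass {a b u₀ u₁ : ℝ} (ha : a ∈ Set.Icc (0 : ℝ) 1)
    (hb : b ∈ Set.Icc (0 : ℝ) 1) (h₀ : 0 ≤ u₀) (h₁ : 0 ≤ u₁) :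
    splitEntropy (channelMass a b u₀ u₁ false) (channelMass a b u₀ u₁ true) =
      (u₀ + u₁) * Real.binEntropy (channelOut a b (u₁ / (u₀ + u₁))) := by
  rw [splitEntropy_eq_mul_binEntropy (channelMass_nonneg ha hb h₀ h₁ _)
    (channelMass_nonneg ha hb h₀ h₁ _), channelMass_false_add_true]
  obtain h | h := (add_nonneg h₀ h₁).eq_or_lt
  · simp [← h]
  congr 2
  simp only [channelMass, binaryChannel, channelOut]
  field_simp
  ring

/-- The strong data processing inequality for the binary channel with a binary source, in terms of
the joint masses `u x y` of the source value `x` and the channel input `y`. -/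
theorem splitEntropy_channelMass_contraction {a b : ℝ} (ha : a ∈ Set.Icc (0 : ℝ) 1)
    (hb : b ∈ Set.Icc (0 : ℝ) 1) {u : Bool → Bool → ℝ} (hu : ∀ x y, 0 ≤ u x y) :
    (1 - transmissionBound a b) *
        splitEntropy (u false false + u false true) (u true false + u true true) +
      transmissionBound a b * (splitEntropy (u false false) (u true false) +
        splitEntropy (u false true) (u true true)) ≤
      splitEntropy (channelMass a b (u false false) (u false true) false)
          (channelMass a b (u true false) (u true true) false) +
        splitEntropy (channelMass a b (u false false) (u false true) true)
          (channelMass a b (u true false) (u true true) true) := by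
  have h := (concaveOn_binEntropy_sub_channelOut ha hb).perspective_superadditive
    (hu false false) (hu false true) (hu true false) (hu true true)
  simp only [mul_sub, mul_left_comm _ (transmissionBound a b)] at h
  rw [← splitEntropy_channelMass ha hb (hu _ _) (hu _ _),
    ← splitEntropy_channelMass ha hb (hu _ _) (hu _ _),
    ← splitEntropy_channelMass ha hb (add_nonneg (hu _ _) (hu _ _))
      (add_nonneg (hu _ _) (hu _ _)),
    ← splitEntropy_eq_mul_binEntropy (hu _ _) (hu _ _),
    ← splitEntropy_eq_mul_binEntropy (hu _ _) (hu _ _),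
    ← splitEntropy_eq_mul_binEntropy (add_nonneg (hu _ _) (hu _ _))
      (add_nonneg (hu _ _) (hu _ _))] at h
  have hmass : ∀ z, channelMass a b (u false false + u true false) (u false true + u true true) z =
      channelMass a b (u false false) (u false true) z +
        channelMass a b (u true false) (u true true) z := by
    intro z; simp only [channelMass]; ring
  rw [hmass, hmass] at h
  -- mutual information is symmetric: both orders of conditioning give the same expression
  simp only [splitEntropy, channelMass_false_add_true,
    add_add_add_comm _ (channelMass a b _ _ _) _ _] at h ⊢
  have e : u false false + u true false + (u false true + u true true) =
      u false false + u false true + (u true false + u true true) := by ring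
  rw [e] at h
  linear_combination h

/-! ### Conditional entropy of the input bit -/

/-- The conditional entropy `H(X | V)`, in nats, of a random bit `X` given a random variable `V`
with finitely many values. -/
noncomputable def condEntropy {Ω β : Type*} [MeasurableSpace Ω] [Fintype β] (μ : Measure Ω)
    (X : Ω → Bool) (V : Ω → β) : ℝ :=
  ∑ v, splitEntropy (μ.real {ω | X ω = false ∧ V ω = v}) (μ.real {ω | X ω = true ∧ V ω = v})

section

variable {Ω β β' : Type*} [MeasurableSpace Ω] {μ : Measure Ω} [IsProbabilityMeasure μ]
  [Fintype β] [MeasurableSpace β] [MeasurableSingletonClass β]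
  [Fintype β'] [MeasurableSpace β'] [MeasurableSingletonClass β']

theorem measureReal_eq_sum_fiber {A : Set Ω} (hA : MeasurableSet A) {V : Ω → β}
    (hV : Measurable V) : μ.real A = ∑ v, μ.real {ω | ω ∈ A ∧ V ω = v} := by
  rw [← measureReal_biUnion_finset]
  · congr 1
    ext ω
    simp
  · intro v _ w _ hvw
    refine Set.disjoint_left.2 fun ω h h' => hvw ?_
    exact h.2.symm.trans h'.2
  · exact fun v _ => hA.inter (hV (measurableSet_singleton v))

theorem mutualInfo_eq_entropy_sub_condEntropy {X : Ω → Bool} (hX : Measurable X) {V : Ω → β}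
    (hV : Measurable V) :
    mutualInfo μ X V =
      (splitEntropy (μ.real {ω | X ω = false}) (μ.real {ω | X ω = true}) - condEntropy μ X V) /
        Real.log 2 := by
  have hXm : ∀ x, MeasurableSet {ω | X ω = x} := fun x => hX (measurableSet_singleton x)
  have hVm : ∀ v, MeasurableSet {ω | V ω = v} := fun v => hV (measurableSet_singleton v)
  have hrow : ∀ x, ∑ v, μ.real {ω | X ω = x ∧ V ω = v} = μ.real {ω | X ω = x} := fun x =>
    (measureReal_eq_sum_fiber (hXm x) hV).symm
  have hcol : ∀ v, μ.real {ω | X ω = false ∧ V ω = v} + μ.real {ω | X ω = true ∧ V ω = v} =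
      μ.real {ω | V ω = v} := fun v => by
    rw [measureReal_eq_sum_fiber (hVm v) hX, Fintype.sum_bool, add_comm]
    simp only [Set.mem_ofPred_eq, and_comm]
  have htot : μ.real {ω | X ω = false} + μ.real {ω | X ω = true} = 1 := by
    rw [← probReal_univ (μ := μ), measureReal_eq_sum_fiber MeasurableSet.univ hX,
      Fintype.sum_bool, add_comm]
    simp
  have hterm : ∀ x v, μ.real {ω | X ω = x ∧ V ω = v} *
      Real.logb 2 (μ.real {ω | X ω = x ∧ V ω = v} /
        (μ.real {ω | X ω = x} * μ.real {ω | V ω = v})) =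
      (-Real.negMulLog (μ.real {ω | X ω = x ∧ V ω = v}) -
        μ.real {ω | X ω = x ∧ V ω = v} * Real.log (μ.real {ω | X ω = x}) -
        μ.real {ω | X ω = x ∧ V ω = v} * Real.log (μ.real {ω | V ω = v})) / Real.log 2 := by
    intro x v
    obtain h | h := (measureReal_nonneg (μ := μ) (s := {ω | X ω = x ∧ V ω = v})).eq_or_lt
    · simp [← h]
    · have hx : 0 < μ.real {ω | X ω = x} := h.trans_le (measureReal_mono fun ω hω => hω.1)
      have hv : 0 < μ.real {ω | V ω = v} := h.trans_le (measureReal_mono fun ω hω => hω.2)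
      rw [Real.logb, Real.log_div h.ne' (mul_pos hx hv).ne', Real.log_mul hx.ne' hv.ne',
        Real.negMulLog]
      ring
  have hvsum : ∀ v, μ.real {ω | X ω = true ∧ V ω = v} * Real.log (μ.real {ω | V ω = v}) +
      μ.real {ω | X ω = false ∧ V ω = v} * Real.log (μ.real {ω | V ω = v}) =
      -Real.negMulLog (μ.real {ω | V ω = v}) := fun v => by
    rw [← add_mul, add_comm, hcol, Real.negMulLog]
    ring
  have hxsum : ∀ x, ∑ v, μ.real {ω | X ω = x ∧ V ω = v} * Real.log (μ.real {ω | X ω = x}) =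
      -Real.negMulLog (μ.real {ω | X ω = x}) := fun x => by
    rw [← Finset.sum_mul, hrow, Real.negMulLog]
    ring
  have hV' := Finset.sum_congr (s₁ := Finset.univ) rfl fun v _ => hvsum v
  rw [Finset.sum_add_distrib] at hV'
  unfold mutualInfo condEntropy
  simp only [hterm, splitEntropy, htot, Real.negMulLog_one, hcol]
  simp only [← Finset.sum_div, Finset.sum_sub_distrib, Fintype.sum_bool, hxsum,
    Finset.sum_add_distrib, Finset.sum_neg_distrib] at hV' ⊢
  congr 1
  linear_combination -hV'

/-- Conditioning on a function of `V` instead of `V` does not decrease the entropy. -/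
theorem condEntropy_le_condEntropy_of_factorsThrough {X : Ω → Bool} (hX : Measurable X)
    {V : Ω → β} (hV : Measurable V) {U : Ω → β'} (hU : Measurable U)
    (h : Function.FactorsThrough U V) : condEntropy μ X V ≤ condEntropy μ X U := by
  have hXm : ∀ x, MeasurableSet {ω | X ω = x} := fun x => hX (measurableSet_singleton x)
  have hUm : ∀ u, MeasurableSet {ω | U ω = u} := fun u => hU (measurableSet_singleton u)
  have hm : ∀ x u, MeasurableSet {ω | X ω = x ∧ U ω = u} := fun x u => (hXm x).inter (hUm u)
  have key : condEntropy μ X V = ∑ u, ∑ v,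
      splitEntropy (μ.real {ω | (X ω = false ∧ U ω = u) ∧ V ω = v})
        (μ.real {ω | (X ω = true ∧ U ω = u) ∧ V ω = v}) := by
    rw [Finset.sum_comm]
    refine Finset.sum_congr rfl fun v _ => ?_
    by_cases hv : ∃ ω, V ω = v
    · obtain ⟨ω₀, rfl⟩ := hv
      -- only the value of `U` determined by that of `V` contributes
      rw [Finset.sum_eq_single (U ω₀)]
      · congr 2 <;> ext ω <;> simp only [Set.mem_ofPred_eq] <;>
          exact ⟨fun hω => ⟨⟨hω.1, h hω.2⟩, hω.2⟩, fun hω => ⟨hω.1.1, hω.2⟩⟩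
      · intro u _ hu
        have : ∀ x, {ω | (X ω = x ∧ U ω = u) ∧ V ω = V ω₀} = ∅ := fun x =>
          Set.eq_empty_of_forall_notMem fun ω hω => hu (hω.1.2.symm.trans (h hω.2))
        simp [this, splitEntropy]
      · simp
    · have hv' : ∀ ω, V ω ≠ v := fun ω hω => hv ⟨ω, hω⟩
      simp [hv', splitEntropy]
  rw [key]
  refine Finset.sum_le_sum fun u _ => ?_
  refine (sum_splitEntropy_le _ (fun _ => measureReal_nonneg)
    fun _ => measureReal_nonneg).trans_eq ?_
  rw [measureReal_eq_sum_fiber (hm false u) hV, measureReal_eq_sum_fiber (hm true u) hV]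
  rfl

theorem mutualInfo_le_mutualInfo_of_factorsThrough {X : Ω → Bool} (hX : Measurable X)
    {V : Ω → β} (hV : Measurable V) {U : Ω → β'} (hU : Measurable U)
    (h : Function.FactorsThrough U V) : mutualInfo μ X U ≤ mutualInfo μ X V := by
  rw [mutualInfo_eq_entropy_sub_condEntropy hX hV, mutualInfo_eq_entropy_sub_condEntropy hX hU]
  have := condEntropy_le_condEntropy_of_factorsThrough (μ := μ) hX hV hU h
  have := (Real.log_pos one_lt_two).le
  gcongr

theorem mutualInfo_le_one {X : Ω → Bool} (hX : Measurable X) {V : Ω → β} (hV : Measurable V) :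
    mutualInfo μ X V ≤ 1 := by
  have hlog := Real.log_pos one_lt_two
  rw [mutualInfo_eq_entropy_sub_condEntropy hX hV, div_le_one hlog]
  have h0 : 0 ≤ condEntropy μ X V := by
    refine Finset.sum_nonneg fun v _ => ?_
    rw [splitEntropy_eq_mul_binEntropy measureReal_nonneg measureReal_nonneg]
    refine mul_nonneg (add_nonneg measureReal_nonneg measureReal_nonneg)
      (Real.binEntropy_nonneg (div_nonneg measureReal_nonneg
        (add_nonneg measureReal_nonneg measureReal_nonneg)) (div_le_one_of_le₀ ?_
        (add_nonneg measureReal_nonneg measureReal_nonneg)))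
    exact le_add_of_nonneg_left measureReal_nonneg
  have htot : μ.real {ω | X ω = false} + μ.real {ω | X ω = true} = 1 := by
    rw [← probReal_univ (μ := μ), measureReal_eq_sum_fiber MeasurableSet.univ hX,
      Fintype.sum_bool, add_comm]
    simp
  rw [splitEntropy_eq_mul_binEntropy measureReal_nonneg measureReal_nonneg, htot, one_mul]
  linarith [Real.binEntropy_le_log_two (p := μ.real {ω | X ω = true} / 1)]

theorem mutualInfo_eq_zero_of_subsingleton [Subsingleton β] {X : Ω → Bool} (hX : Measurable X)
    {V : Ω → β} (hV : Measurable V) : mutualInfo μ X V = 0 := by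
  rw [mutualInfo_eq_entropy_sub_condEntropy hX hV]
  obtain ⟨ω₀⟩ := μ.nonempty_of_neZero
  have hu : (Finset.univ : Finset β) = {V ω₀} :=
    Finset.eq_singleton_iff_unique_mem.2 ⟨Finset.mem_univ _, fun v _ => Subsingleton.elim _ _⟩
  simp [condEntropy, hu, Subsingleton.elim (V _) (V ω₀)]

/-- The strong data processing inequality with side information `T`: if `Z` arises from the bit `Y`
through the binary channel, independently of everything else, then `Z` adds to the information
about `X` at most the fraction `transmissionBound a b` of what `Y` adds. -/
theorem mutualInfo_channel_le {a b : ℝ} (ha : a ∈ Set.Icc (0 : ℝ) 1)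
    (hb : b ∈ Set.Icc (0 : ℝ) 1) {X Y Z : Ω → Bool} {T : Ω → β} (hX : Measurable X)
    (hY : Measurable Y) (hZ : Measurable Z) (hT : Measurable T)
    (hchannel : ∀ x t y z, μ.real {ω | (X ω = x ∧ T ω = t ∧ Y ω = y) ∧ Z ω = z} =
      μ.real {ω | X ω = x ∧ T ω = t ∧ Y ω = y} * binaryChannel a b y z) :
    mutualInfo μ X (fun ω => (T ω, Z ω)) ≤
      (1 - transmissionBound a b) * mutualInfo μ X T +
        transmissionBound a b * mutualInfo μ X (fun ω => (T ω, Y ω)) := by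
  have hYm : ∀ y, MeasurableSet {ω | Y ω = y} := fun y => hY (measurableSet_singleton y)
  have hXm : ∀ x, MeasurableSet {ω | X ω = x} := fun x => hX (measurableSet_singleton x)
  have hTm : ∀ t, MeasurableSet {ω | T ω = t} := fun t => hT (measurableSet_singleton t)
  have hZm : ∀ z, MeasurableSet {ω | Z ω = z} := fun z => hZ (measurableSet_singleton z)
  have hsum : ∀ x t, μ.real {ω | X ω = x ∧ T ω = t} =
      μ.real {ω | X ω = x ∧ T ω = t ∧ Y ω = false} +
        μ.real {ω | X ω = x ∧ T ω = t ∧ Y ω = true} := fun x t => by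
    rw [measureReal_eq_sum_fiber (A := {ω | X ω = x ∧ T ω = t}) ((hXm x).inter (hTm t)) hY,
      Fintype.sum_bool, add_comm]
    simp only [Set.mem_ofPred_eq, and_assoc]
  have hout : ∀ x t z, μ.real {ω | X ω = x ∧ T ω = t ∧ Z ω = z} =
      channelMass a b (μ.real {ω | X ω = x ∧ T ω = t ∧ Y ω = false})
        (μ.real {ω | X ω = x ∧ T ω = t ∧ Y ω = true}) z := fun x t z => by
    rw [channelMass, ← hchannel, ← hchannel, measureReal_eq_sum_fiber
      (A := {ω | X ω = x ∧ T ω = t ∧ Z ω = z}) ((hXm x).inter ((hTm t).inter (hZm z))) hY,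
      Fintype.sum_bool, add_comm]
    congr 2 <;> ext ω <;> simp only [Set.mem_ofPred_eq] <;> tauto
  have hpair : ∀ U : Ω → Bool, condEntropy μ X (fun ω => (T ω, U ω)) = ∑ t,
      (splitEntropy (μ.real {ω | X ω = false ∧ T ω = t ∧ U ω = false})
          (μ.real {ω | X ω = true ∧ T ω = t ∧ U ω = false}) +
        splitEntropy (μ.real {ω | X ω = false ∧ T ω = t ∧ U ω = true})
          (μ.real {ω | X ω = true ∧ T ω = t ∧ U ω = true})) := fun U => by
    simp only [condEntropy, Fintype.sum_prod_type, Fintype.sum_bool, Prod.mk.injEq]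
    exact Finset.sum_congr rfl fun t _ => add_comm _ _
  have key : (1 - transmissionBound a b) * condEntropy μ X T +
      transmissionBound a b * condEntropy μ X (fun ω => (T ω, Y ω)) ≤
      condEntropy μ X (fun ω => (T ω, Z ω)) := by
    rw [hpair, hpair, condEntropy, Finset.mul_sum, Finset.mul_sum, ← Finset.sum_add_distrib]
    refine Finset.sum_le_sum fun t _ => ?_
    simp only [hsum, hout]
    exact splitEntropy_channelMass_contraction ha hb
      (u := fun x y => μ.real {ω | X ω = x ∧ T ω = t ∧ Y ω = y}) fun x y => measureReal_nonneg
  have hlog := Real.log_pos one_lt_two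
  rw [mutualInfo_eq_entropy_sub_condEntropy hX (hT.prodMk hZ),
    mutualInfo_eq_entropy_sub_condEntropy hX hT,
    mutualInfo_eq_entropy_sub_condEntropy hX (hT.prodMk hY), mul_div_assoc', mul_div_assoc',
    ← add_div]
  gcongr
  linarith

end

/-! ### Circuits and their paths -/

namespace Circuit

section

variable {κ γ E : Type*} (C : Circuit κ γ E)

theorem not_downstream_src {g : γ} {e : E} (he : C.tgt e = some g) :
    ¬ C.Downstream (Vertex.gate g) (C.src e) := fun h =>
  C.acyclic (Vertex.gate g) (Relation.TransGen.tail' h ⟨e, g, rfl, he, rfl⟩)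

theorem not_downstream_var (g : γ) : ¬ C.Downstream (Vertex.gate g) Vertex.var := fun h => by
  rcases Relation.ReflTransGen.cases_tail h with h | ⟨u, -, e, g', -, -, h⟩ <;> cases h

theorem wellFounded_transGen_flip [Finite κ] [Finite γ] :
    WellFounded (flip (Relation.TransGen C.Adj)) :=
  letI : IsTrans _ (flip (Relation.TransGen C.Adj)) := ⟨fun _ _ _ h h' => h'.trans h⟩
  letI : Std.Irrefl (flip (Relation.TransGen C.Adj)) := ⟨C.acyclic⟩
  Finite.wellFounded_of_trans_of_irrefl _

/-- The wires that enter the gate `g`. -/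
noncomputable def inWires [Finite E] (g : γ) : Finset E :=
  (Set.toFinite {e | C.tgt e = some g}).toFinset

@[simp]
theorem mem_inWires [Finite E] {g : γ} {e : E} : e ∈ C.inWires g ↔ C.tgt e = some g := by
  simp [inWires]

variable [Finite κ] [Finite γ]

@[simp]
theorem mem_paths {W : Finset E} {P : List (Vertex κ γ)} : P ∈ C.paths W ↔ C.IsPathTo W P := by
  simp [paths]

/-- The sum over all paths to `W` of the powers of `c` counting the gates on the path. -/
noncomputable def pathSum (c : ℝ) (W : Finset E) : ℝ :=
  ∑ P ∈ C.paths W, c ^ gateCount P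

variable {c : ℝ}

theorem pathSum_nonneg (hc : 0 ≤ c) (W : Finset E) : 0 ≤ C.pathSum c W :=
  Finset.sum_nonneg fun _ _ => pow_nonneg hc _

theorem pathSum_mono (hc : 0 ≤ c) {V W : Finset E} (h : V ⊆ W) :
    C.pathSum c V ≤ C.pathSum c W := by
  refine Finset.sum_le_sum_of_subset_of_nonneg (fun P hP => ?_) fun _ _ _ => pow_nonneg hc _
  rw [mem_paths] at hP ⊢
  obtain ⟨h1, h2, e, he, h3⟩ := hP
  exact ⟨h1, h2, e, h he, h3⟩

theorem pathSum_union_le [DecidableEq E] (hc : 0 ≤ c) (V W : Finset E) :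
    C.pathSum c (V ∪ W) ≤ C.pathSum c V + C.pathSum c W := by
  classical
  have hsub : C.paths (V ∪ W) ⊆ C.paths V ∪ C.paths W := by
    intro P hP
    simp only [mem_paths, Finset.mem_union] at hP ⊢
    obtain ⟨h1, h2, e, he, h3⟩ := hP
    exact (Finset.mem_union.1 he).imp (fun he => ⟨h1, h2, e, he, h3⟩)
      fun he => ⟨h1, h2, e, he, h3⟩
  unfold pathSum
  refine (Finset.sum_le_sum_of_subset_of_nonneg hsub fun _ _ _ => pow_nonneg hc _).trans ?_
  rw [← Finset.sum_union_inter]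
  exact le_add_of_nonneg_right (Finset.sum_nonneg fun _ _ => pow_nonneg hc _)

theorem one_le_pathSum (hc : 0 ≤ c) {W : Finset E} {e : E} (he : e ∈ W)
    (hsrc : C.src e = Vertex.var) : 1 ≤ C.pathSum c W := by
  have hmem : [Vertex.var] ∈ C.paths W := by
    rw [mem_paths]
    exact ⟨List.isChain_singleton _, rfl, e, he, by simp [hsrc]⟩
  refine le_trans ?_ (Finset.single_le_sum (fun _ _ => pow_nonneg hc _) hmem)
  simp [gateCount, Vertex.isGate]

/-- The paths to the gate `g` are those to its incoming wires, extended by `g`. -/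
theorem pathSum_add_mul_inWires_le [Finite E] (hc : 0 ≤ c) {g : γ} {V W : Finset E}
    (hVW : V ⊆ W) (hV : ∀ e ∈ V, C.src e ≠ Vertex.gate g)
    (hW : ∃ e ∈ W, C.src e = Vertex.gate g) :
    C.pathSum c V + c * C.pathSum c (C.inWires g) ≤ C.pathSum c W := by
  classical
  have hinj : Set.InjOn (fun P : List (Vertex κ γ) => P ++ [Vertex.gate g])
      (C.paths (C.inWires g)) := fun P _ Q _ h => List.append_cancel_right h
  have hdisj : Disjoint (C.paths V)
      ((C.paths (C.inWires g)).image fun P => P ++ [Vertex.gate g]) := by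
    refine Finset.disjoint_left.2 fun P hP hP' => ?_
    obtain ⟨Q, -, rfl⟩ := Finset.mem_image.1 hP'
    obtain ⟨-, -, e, he, h⟩ := C.mem_paths.1 hP
    rw [List.getLast?_concat] at h
    exact hV e he (Option.some.inj h).symm
  have hsum : c * C.pathSum c (C.inWires g) =
      ∑ P ∈ (C.paths (C.inWires g)).image fun P => P ++ [Vertex.gate g], c ^ gateCount P := by
    rw [Finset.sum_image hinj, pathSum, Finset.mul_sum]
    refine Finset.sum_congr rfl fun P _ => ?_
    simp [gateCount, List.countP_append, Vertex.isGate, pow_succ']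
  rw [hsum, pathSum, ← Finset.sum_union hdisj]
  refine Finset.sum_le_sum_of_subset_of_nonneg (fun P hP => ?_) fun _ _ _ => pow_nonneg hc _
  rw [mem_paths]
  rcases Finset.mem_union.1 hP with hP | hP
  · obtain ⟨h1, h2, e, he, h3⟩ := C.mem_paths.1 hP
    exact ⟨h1, h2, e, hVW he, h3⟩
  · obtain ⟨Q, hQ, rfl⟩ := Finset.mem_image.1 hP
    obtain ⟨h1, h2, e, he, h3⟩ := C.mem_paths.1 hQ
    obtain ⟨e', he', hsrc⟩ := hW
    refine ⟨List.isChain_append.2 ⟨h1, List.isChain_singleton _, ?_⟩, ?_, e', he', ?_⟩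
    · intro u hu v hv
      rw [h3, Option.mem_some_iff] at hu
      rw [List.head?_singleton, Option.mem_some_iff] at hv
      exact ⟨e, g, hu, C.mem_inWires.1 he, hv.symm⟩
    · rw [List.head?_append, h2, Option.some_or]
    · rw [List.getLast?_concat, hsrc]

end

/-! ### Information carried by wires -/

section

variable {κ γ E Ω : Type*} [MeasurableSpace Ω] {μ : Measure Ω} {C : Circuit κ γ E} {a b : ℝ}
  {X : Ω → Bool} {Z : Vertex κ γ → Ω → Bool}

theorem IsNoisyRun.measurable_wires (hZ : C.IsNoisyRun a b μ X Z) (W : Finset E) :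
    Measurable fun ω (e : W) => Z (C.src e.1) ω :=
  measurable_pi_lambda _ fun _ => hZ.measurable _

theorem IsNoisyRun.measurable_input (hZ : C.IsNoisyRun a b μ X Z) : Measurable X :=
  hZ.var_eq ▸ hZ.measurable Vertex.var

variable [Finite κ] [Finite γ] [IsProbabilityMeasure μ]

/-- The noise of a gate is independent of every event that concerns only vertices that are not
downstream of the gate and that determines the noiseless result. -/
theorem IsNoisyRun.measureReal_and_gate_eq (hZ : C.IsNoisyRun a b μ X Z) (g : γ)
    {p : (Vertex κ γ → Bool) → Prop}
    (hp : ∀ s s', (∀ v, ¬ C.Downstream (Vertex.gate g) v → s v = s' v) → p s → p s')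
    {y : Bool} (hy : ∀ s, p s → C.preNoise s g = y) (z : Bool) :
    μ.real {ω | p (fun v => Z v ω) ∧ Z (Vertex.gate g) ω = z} =
      μ.real {ω | p (fun v => Z v ω)} * binaryChannel a b y z := by
  classical
  have hZm : Measurable fun ω v => Z v ω := measurable_pi_lambda _ hZ.measurable
  have hpm : MeasurableSet {ω | p (fun v => Z v ω)} :=
    hZm (Set.toFinite {s | p s}).measurableSet
  have hzm : MeasurableSet {ω | Z (Vertex.gate g) ω = z} :=
    hZ.measurable _ (measurableSet_singleton z)
  let N := {v // ¬ C.Downstream (Vertex.gate g) v}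
  let _ : Fintype N := Fintype.ofFinite N
  have hR : Measurable fun ω (v : N) => Z v.1 ω :=
    measurable_pi_lambda _ fun v => hZ.measurable v.1
  rw [measureReal_eq_sum_fiber
      (A := {ω | p (fun v => Z v ω) ∧ Z (Vertex.gate g) ω = z}) (hpm.inter hzm) hR,
    measureReal_eq_sum_fiber hpm hR, Finset.sum_mul]
  refine Finset.sum_congr rfl fun r _ => ?_
  simp only [Set.mem_ofPred_eq]
  by_cases h : ∃ ω, p (fun v => Z v ω) ∧ (fun v : N => Z v.1 ω) = r
  · obtain ⟨ω₀, h₀, rfl⟩ := h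
    have hiff : ∀ ω, (p (fun v => Z v ω) ∧ (fun v : N => Z v.1 ω) = fun v : N => Z v.1 ω₀) ↔
        ∀ v, ¬ C.Downstream (Vertex.gate g) v → Z v ω = Z v ω₀ := fun ω =>
      ⟨fun h v hv => congrFun h.2 ⟨v, hv⟩,
        fun h => ⟨hp _ _ (fun v hv => (h v hv).symm) h₀, funext fun v => h v.1 v.2⟩⟩
    have := hZ.gate_noise g (fun v => Z v ω₀) z
    rw [hy _ h₀] at this
    simp only [and_right_comm (c := (_ : N → Bool) = _), hiff]
    exact this
  · have h1 : ∀ ω, ¬ (p (fun v => Z v ω) ∧ (fun v : N => Z v.1 ω) = r) := fun ω hω => h ⟨ω, hω⟩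
    simp [and_right_comm (c := (_ : N → Bool) = _), h1]

variable [Finite E] [DecidableEq E]

/-- The effect on the information about `X` of replacing a gate `g` by its incoming wires, when
none of the other wires under consideration leaves a vertex downstream of `g`. -/
theorem IsNoisyRun.mutualInfo_wires_le (hZ : C.IsNoisyRun a b μ X Z)
    (ha : a ∈ Set.Icc (0 : ℝ) 1) (hb : b ∈ Set.Icc (0 : ℝ) 1) {g : γ} {V W : Finset E}
    (hV : ∀ e ∈ V, ¬ C.Downstream (Vertex.gate g) (C.src e))
    (hW : ∀ e ∈ W, e ∉ V → C.src e = Vertex.gate g) :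
    mutualInfo μ X (fun ω (e : W) => Z (C.src e.1) ω) ≤
      (1 - transmissionBound a b) * mutualInfo μ X (fun ω (e : V) => Z (C.src e.1) ω) +
        transmissionBound a b *
          mutualInfo μ X (fun ω (e : ↥(V ∪ C.inWires g)) => Z (C.src e.1) ω) := by
  have hX := hZ.measurable_input
  have hT := hZ.measurable_wires V
  have hG := hZ.measurable (Vertex.gate g)
  have hY : Measurable fun ω => C.preNoise (fun v => Z v ω) g :=
    (measurable_of_finite fun s : Vertex κ γ → Bool => C.preNoise s g).comp
      (measurable_pi_lambda _ hZ.measurable)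
  have h1 : mutualInfo μ X (fun ω (e : W) => Z (C.src e.1) ω) ≤
      mutualInfo μ X (fun ω => ((fun e : V => Z (C.src e.1) ω), Z (Vertex.gate g) ω)) := by
    refine mutualInfo_le_mutualInfo_of_factorsThrough hX (hT.prodMk hG) (hZ.measurable_wires W) ?_
    intro ω ω' h
    funext e
    by_cases he : e.1 ∈ V
    · exact congrFun (congrArg Prod.fst h) ⟨e.1, he⟩
    · have := congrArg Prod.snd h
      simpa only [hW e.1 e.2 he] using this
  have h2 := mutualInfo_channel_le (μ := μ) ha hb hX hY hG hT fun x t y z => by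
    have := hZ.measureReal_and_gate_eq g
      (p := fun s => s Vertex.var = x ∧ (fun e : V => s (C.src e.1)) = t ∧ C.preNoise s g = y)
      (y := y) ?_ (fun s hs => hs.2.2) z
    · simpa only [hZ.var_eq] using this
    · rintro s s' hs ⟨hx, ht, hy⟩
      refine ⟨hs _ (C.not_downstream_var g) ▸ hx, ?_, ?_⟩
      · rw [← ht]
        exact funext fun e => (hs _ (hV e.1 e.2)).symm
      · rw [← hy]
        exact congrArg (C.compute g) (funext fun e => (hs _ (C.not_downstream_src e.2)).symm)
  have h3 : mutualInfo μ X
      (fun ω => ((fun e : V => Z (C.src e.1) ω), C.preNoise (fun v => Z v ω) g)) ≤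
      mutualInfo μ X (fun ω (e : ↥(V ∪ C.inWires g)) => Z (C.src e.1) ω) := by
    refine mutualInfo_le_mutualInfo_of_factorsThrough hX (hZ.measurable_wires _) (hT.prodMk hY) ?_
    intro ω ω' h
    refine Prod.ext (funext fun e => ?_) (congrArg (C.compute g) (funext fun e => ?_))
    · exact congrFun h ⟨e.1, Finset.mem_union_left _ e.2⟩
    · exact congrFun h ⟨e.1, Finset.mem_union_right _ (C.mem_inWires.2 e.2)⟩
  refine h1.trans (h2.trans ?_)
  have := mul_le_mul_of_nonneg_left h3 (transmissionBound_nonneg ha hb)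
  linarith

/-- The bound for wires leaving a set `D` of vertices that is closed under predecessors; the
induction removes a vertex of `D` with nothing downstream in `D`. -/
theorem IsNoisyRun.mutualInfo_le_pathSum_of_src_mem (hZ : C.IsNoisyRun a b μ X Z)
    (ha : a ∈ Set.Icc (0 : ℝ) 1) (hb : b ∈ Set.Icc (0 : ℝ) 1) (D : Finset (Vertex κ γ))
    (hD : ∀ u v, C.Adj u v → v ∈ D → u ∈ D) (W : Finset E) (hW : ∀ e ∈ W, C.src e ∈ D) :
    mutualInfo μ X (fun ω (e : W) => Z (C.src e.1) ω) ≤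
      C.pathSum (transmissionBound a b) W := by
  classical
  induction D using Finset.strongInductionOn generalizing W with
  | _ D ih =>
  have hX := hZ.measurable_input
  have hc := transmissionBound_nonneg ha hb
  obtain rfl | hne := D.eq_empty_or_nonempty
  · obtain rfl : W = ∅ := Finset.eq_empty_of_forall_notMem fun e he => by simpa using hW e he
    rw [mutualInfo_eq_zero_of_subsingleton hX (hZ.measurable_wires _)]
    exact C.pathSum_nonneg hc _
  obtain ⟨m, hm, hmax⟩ := C.wellFounded_transGen_flip.has_min (D : Set (Vertex κ γ)) hne
  have ih' := ih (D.erase m) (Finset.erase_ssubset hm) fun u v huv hv =>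
    Finset.mem_erase.2 ⟨fun h => hmax v (Finset.mem_of_mem_erase hv) (h ▸ .single huv),
      hD u v huv (Finset.mem_of_mem_erase hv)⟩
  let V := W.filter fun e => C.src e ≠ m
  have hVW : V ⊆ W := Finset.filter_subset _ _
  have hWV : ∀ e ∈ W, e ∉ V → C.src e = m := fun e he heV => by
    by_contra h
    exact heV (Finset.mem_filter.2 ⟨he, h⟩)
  have hVD : ∀ e ∈ V, C.src e ∈ D.erase m := fun e he =>
    Finset.mem_erase.2 ⟨(Finset.mem_filter.1 he).2, hW e (hVW he)⟩
  by_cases hWm : ∀ e ∈ W, C.src e ≠ m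
  · exact ih' W fun e he => Finset.mem_erase.2 ⟨hWm e he, hW e he⟩
  push Not at hWm
  have ihV := ih' V hVD
  cases m with
  | var =>
    obtain ⟨e, he, hsrc⟩ := hWm
    exact (mutualInfo_le_one hX (hZ.measurable_wires W)).trans (C.one_le_pathSum hc he hsrc)
  | const i =>
    refine (mutualInfo_le_mutualInfo_of_factorsThrough hX (hZ.measurable_wires V)
      (hZ.measurable_wires W) fun ω ω' h => funext fun e => ?_).trans
      (ihV.trans (C.pathSum_mono hc hVW))
    by_cases he : e.1 ∈ V
    · exact congrFun h ⟨e.1, he⟩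
    · simp only [hWV e.1 e.2 he, hZ.const_eq]
  | gate g =>
    have hdown : ∀ e ∈ V, ¬ C.Downstream (Vertex.gate g) (C.src e) := fun e he h =>
      (Relation.reflTransGen_iff_eq_or_transGen.1 h).elim (Finset.mem_filter.1 he).2
        (hmax _ (hW e (hVW he)))
    have ihU := ih' (V ∪ C.inWires g) fun e he => by
      rcases Finset.mem_union.1 he with he | he
      · exact hVD e he
      · have htgt := C.mem_inWires.1 he
        have hadj : C.Adj (C.src e) (Vertex.gate g) := ⟨e, g, rfl, htgt, rfl⟩
        refine Finset.mem_erase.2 ⟨fun h => ?_, hD _ _ hadj hm⟩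
        exact C.not_downstream_src htgt (h ▸ Relation.ReflTransGen.refl)
    have h1 := hZ.mutualInfo_wires_le ha hb hdown hWV
    have h2 := C.pathSum_union_le hc V (C.inWires g)
    have h3 := C.pathSum_add_mul_inWires_le hc hVW
      (fun e he => (Finset.mem_filter.1 he).2) hWm
    have h4 := mul_le_mul_of_nonneg_left ihV
      (sub_nonneg.2 (transmissionBound_le_one a b))
    have h5 := mul_le_mul_of_nonneg_left (ihU.trans h2) hc
    linarith

end

end Circuit

theorem mainTheorem2 {κ γ E Ω : Type*} [Finite κ] [Finite γ] [Finite E] [DecidableEq E]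
    [MeasurableSpace Ω] (μ : Measure Ω) [IsProbabilityMeasure μ]
    (C : Circuit κ γ E) (a b : ℝ) (ha : a ∈ Set.Icc (0 : ℝ) 1) (hb : b ∈ Set.Icc (0 : ℝ) 1)
    (X : Ω → Bool) (Z : Vertex κ γ → Ω → Bool) (hZ : C.IsNoisyRun a b μ X Z) (W : Finset E) :
    mutualInfo μ X (fun ω (e : W) => Z (C.src e.1) ω) ≤
      ∑ P ∈ C.paths W, transmissionBound a b ^ gateCount P := by
  have := Fintype.ofFinite (Vertex κ γ)
  exact hZ.mutualInfo_le_pathSum_of_src_mem ha hb Finset.univ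
    (fun _ _ _ _ => Finset.mem_univ _) W fun _ _ => Finset.mem_univ _
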